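/- For a finite connected simple graph $G$, let $H(G)=\sum_{\{u,v\}} \frac{1}{d(u,v)}$ be its Harary index, where the sum runs over all unordered pairs of distinct vertices and $d(u,v)$ is the distance in $G$. For integers $n\ge 2$ and $m$ with $\frac{n-1}{2}<m\le n-1$, let the spur $A_{n,m}$ be the tree on $n$ vertices obtained from the star $S_{m+1}$ (a center with $m$ pendent vertices adjacent to it) by attaching one additional pendent vertex to each of $n-m-1$ of these $m$ pendent vertices. Let $T$ be a tree on $n\ge 2$ vertices with independence number $\alpha$ (the maximum size of an independent set of vertices). Then $$H(T)\le \frac{1}{24}\left(3n^2+2\alpha n+\alpha^2-9\alpha+19n-22\right),$$ and equality holds if and only if $T\cong A_{n,\alpha}$. -/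

import Mathlib

/-- The Harary index of a finite graph `G`: half the sum of all entries of the reciprocal distance
matrix, i.e. the sum of `1 / d(u, v)` over all unordered pairs of distinct vertices of a connected
graph. The diagonal of that matrix is zero: `d(u, u) = 0` and `(0 : ℝ)⁻¹ = 0`. -/
noncomputable def hararyIndex {V : Type*} [Fintype V] (G : SimpleGraph V) : ℝ :=
  (1 / 2) * ∑ u : V, ∑ v : V, ((G.dist u v : ℕ) : ℝ)⁻¹

/-- The spur `A_{n,m}`, for `(n - 1) / 2 < m ≤ n - 1`, on the vertex set `{0, …, n - 1}`:
vertex `0` is the center of a star with leaves `1, …, m`, and each of the `n - m - 1` leaves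
`i = 1, …, n - m - 1` of the star gets one further pendent neighbour, the vertex `m + i`. -/
def spur (n m : ℕ) : SimpleGraph (Fin n) :=
  SimpleGraph.fromRel fun i j : Fin n =>
    ((i : ℕ) = 0 ∧ 1 ≤ (j : ℕ) ∧ (j : ℕ) ≤ m) ∨ (1 ≤ (i : ℕ) ∧ (j : ℕ) = m + (i : ℕ))

/-! Induction on the number of vertices. By `IsTree.exists_pendant`, a deepest vertex of a rooted
tree with more than one edge gives either a leaf with a twin leaf, or a pendant path of two
vertices. Deleting the leaf or the path lowers the independence number by exactly one, and the
Harary index drops by a sum of a decreasing function of the distance to the attachment vertex (plus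
1 for the edge of the path).

Neighbourhoods in a tree are independent, so degrees are at most α. Hence `Connected.sum_dist_le`
bounds that sum by its value when the attachment vertex has degree α and eccentricity at most two,
and this value is exactly the increment of `spurBound`. Equality therefore forces a spur centre in
the smaller tree, and the property `IsSpurCenter` passes through both deletions in both directions.
Finally, a tree with a spur centre is the spur, because two vertices at distance two with the same
parent would produce an independent set of size α + 1. -/

namespace SimpleGraph

/-! ### Deleting a pendant vertex -/

section
open scoped Classical
variable {V W : Type*}

/-- `T` arises from `T'`, embedded by `e`, by attaching the pendant vertex `v` at `e x`. -/
structure IsPendant (T : SimpleGraph V) (T' : SimpleGraph W) (e : T' ↪g T) (v : V) (x : W) :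
    Prop where
  ne_iff : ∀ u, u ≠ v ↔ ∃ a, e a = u
  adj_iff : ∀ u, T.Adj v u ↔ u = e x

variable {T : SimpleGraph V} {T' : SimpleGraph W} {e : T' ↪g T} {v : V} {x : W}

lemma exists_isPendant {V : Type u} [Fintype V] {T : SimpleGraph V} (hT : T.IsTree) {v w : V}
    (hv : ∀ u, T.Adj v u ↔ u = w) :
    ∃ (W : Type u) (_ : Fintype W) (T' : SimpleGraph W) (e : T' ↪g T) (x : W),
      IsPendant T T' e v x ∧ e x = w ∧ T'.IsTree := by
  have hvw : T.Adj v w := (hv w).2 rfl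
  refine ⟨↥({v}ᶜ : Set V), inferInstance, T.induce {v}ᶜ, Embedding.induce _,
    ⟨w, fun h => hvw.ne h.symm⟩, ⟨fun u => ?_, fun u => hv u⟩, rfl, ?_, hT.isAcyclic.induce _⟩
  · exact ⟨fun h => ⟨⟨u, h⟩, rfl⟩, fun ⟨a, ha⟩ => ha ▸ a.2⟩
  · apply hT.connected.induce_compl_singleton_of_degree_eq_one
    rw [degree_eq_one_iff_existsUnique_adj]
    exact ⟨w, hvw, fun y hy => (hv y).1 hy⟩

namespace IsPendant

lemma apply_ne (h : IsPendant T T' e v x) (a : W) : e a ≠ v := (h.ne_iff _).2 ⟨a, rfl⟩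

lemma sum_eq [Fintype V] [Fintype W] {M : Type*} [AddCommMonoid M]
    (h : IsPendant T T' e v x) (f : V → M) : ∑ u, f u = f v + ∑ a, f (e a) := by
  have : (Finset.univ : Finset V) = insert v (Finset.univ.map e.toEmbedding) := by
    ext u
    by_cases hu : u = v
    · simp [hu]
    · simpa [hu] using (h.ne_iff u).1 hu
  rw [this, Finset.sum_insert, Finset.sum_map]
  · rfl
  · simpa using h.apply_ne

lemma card_eq [Fintype V] [Fintype W] (h : IsPendant T T' e v x) :
    Fintype.card V = Fintype.card W + 1 := by
  have := h.sum_eq (fun _ => 1)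
  simp only [Finset.sum_const, Finset.card_univ, smul_eq_mul, mul_one] at this
  omega

/-- Folding `v` onto `x` retracts `T` onto `T'` and does not lengthen walks. -/
lemma dist_apply (h : IsPendant T T' e v x) (hc : T'.Connected) (a b : W) :
    T.dist (e a) (e b) = T'.dist a b := by
  apply le_antisymm
  · obtain ⟨p, hp⟩ := hc.exists_walk_length_eq_dist a b
    rw [← hp, ← Walk.length_map e.toHom p]
    exact dist_le _
  · have hex : ∀ u : V, ∃ a : W, (u = v → a = x) ∧ (u ≠ v → e a = u) := fun u => by
      by_cases hu : u = v
      · exact ⟨x, fun _ => rfl, fun h => absurd hu h⟩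
      · obtain ⟨a, ha⟩ := (h.ne_iff u).1 hu
        exact ⟨a, fun h => absurd h hu, fun _ => ha⟩
    choose f hf hf' using hex
    have key : ∀ {u u' : V} (p : T.Walk u u'), T'.dist (f u) (f u') ≤ p.length := by
      intro u u' p
      induction p with
      | nil => simp
      | @cons u y u' hadj p ih =>
        have h1 : T'.dist (f u) (f y) ≤ 1 := by
          by_cases hu : u = v
          · have : f y = x := by
              apply e.injective
              rw [hf' y (by rintro rfl; exact hadj.ne hu), (h.adj_iff y).1 (hu ▸ hadj)]
            rw [hf u hu, this, dist_self]
            omega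
          · by_cases hy : y = v
            · have : f u = x := by
                apply e.injective
                rw [hf' u hu, (h.adj_iff u).1 (hy ▸ hadj.symm)]
              rw [hf y hy, this, dist_self]
              omega
            · rw [dist_eq_one_iff_adj.2]
              rw [← e.map_adj_iff, hf' u hu, hf' y hy]
              exact hadj
        have := hc.dist_triangle (u := f u) (v := f y) (w := f u')
        rw [Walk.length_cons]
        omega
    have hfe : ∀ a, f (e a) = a := fun a => e.injective (hf' _ (h.apply_ne a))
    by_cases hr : T.Reachable (e a) (e b)
    · obtain ⟨p, hp⟩ := hr.exists_walk_length_eq_dist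
      have := key p
      rwa [hfe, hfe, hp] at this
    · exact absurd ((hc a b).map e.toHom) hr

lemma dist_left (h : IsPendant T T' e v x) (hc : T'.Connected) (a : W) :
    T.dist v (e a) = T'.dist x a + 1 := by
  have hvx : T.Adj v (e x) := (h.adj_iff _).2 rfl
  rw [← h.dist_apply hc]
  have hr : T.Reachable (e x) (e a) := (hc x a).map e.toHom
  apply le_antisymm
  · obtain ⟨p, hp⟩ := hr.exists_walk_length_eq_dist
    rw [← hp, ← Walk.length_cons hvx p]
    exact dist_le _
  · obtain ⟨p, hp⟩ := (hvx.reachable.trans hr).exists_walk_length_eq_dist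
    rw [← hp]
    cases p with
    | nil => exact absurd rfl (h.apply_ne a)
    | @cons _ y _ hadj p =>
      obtain rfl := (h.adj_iff y).1 hadj
      rw [Walk.length_cons]
      have := dist_le p
      omega

lemma hararyIndex_eq [Fintype V] [Fintype W] (h : IsPendant T T' e v x) (hc : T'.Connected) :
    hararyIndex T = hararyIndex T' + ∑ a, ((T'.dist x a : ℝ) + 1)⁻¹ := by
  unfold hararyIndex
  rw [h.sum_eq]
  simp only [h.sum_eq, h.dist_apply hc, h.dist_left hc, dist_comm (u := e _) (v := v)]
  rw [Finset.sum_add_distrib]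
  push_cast
  simp only [dist_self]
  ring_nf

lemma degree_eq [Fintype V] [Fintype W] (h : IsPendant T T' e v x) (a : W) :
    T.degree (e a) = T'.degree a + if a = x then 1 else 0 := by
  have aux : ∀ {U : Type _} [Fintype U] (G : SimpleGraph U) (u : U),
      G.degree u = ∑ y, if G.Adj u y then 1 else 0 := by
    intro U _ G u
    rw [← card_neighborFinset_eq_degree, neighborFinset_eq_filter, Finset.card_filter]
  have aux' : T'.degree a = ∑ y, if T'.Adj a y then 1 else 0 := by
    rw [← card_neighborFinset_eq_degree, neighborFinset_eq_filter, Finset.card_filter]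
  rw [aux, aux', h.sum_eq]
  simp only [e.map_adj_iff, T.adj_comm (e a) v, h.adj_iff, e.injective.eq_iff]
  ring

end IsPendant

/-! ### Independence numbers and pendant deletions -/

/-- An embedding pulls independent sets back. -/
lemma card_filter_range_le_indepNum [Finite V] [Fintype W] (e : T' ↪g T) {s : Finset V}
    (hs : T.IsIndepSet s) :
    (Finset.univ.filter fun a => e a ∈ s).card ≤ T'.indepNum := by
  apply IsIndepSet.card_le_indepNum
  intro a ha b hb hab hadj
  simp only [Finset.coe_filter, Finset.mem_univ, true_and, Set.mem_ofPred_eq] at ha hb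
  exact hs ha hb (e.injective.ne hab) (e.map_adj_iff.2 hadj)

lemma IsIndepSet.map_embedding (e : T' ↪g T) {s : Finset W} (hs : T'.IsIndepSet s) :
    T.IsIndepSet (s.map e.toEmbedding) := by
  intro a ha b hb hab hadj
  simp only [Finset.coe_map, Set.mem_image, Finset.mem_coe] at ha hb
  obtain ⟨a, ha, rfl⟩ := ha
  obtain ⟨b, hb, rfl⟩ := hb
  exact hs ha hb (fun h => hab (h ▸ rfl)) (e.map_adj_iff.1 hadj)

lemma isIndepSet_insert_of {s : Finset V} (hs : T.IsIndepSet s) {v : V}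
    (h : ∀ u ∈ s, ¬ T.Adj v u) : T.IsIndepSet (insert v s : Finset V) := by
  intro a ha b hb hab hadj
  simp only [Finset.coe_insert, Set.mem_insert_iff, Finset.mem_coe] at ha hb
  rcases ha with rfl | ha <;> rcases hb with rfl | hb
  · exact hab rfl
  · exact h b hb hadj
  · exact h a ha hadj.symm
  · exact hs ha hb hab hadj

lemma IsPendant.card_eq_add_card_filter [Fintype V] [Fintype W] (h : IsPendant T T' e v x)
    (s : Finset V) :
    s.card = (if v ∈ s then 1 else 0) + (Finset.univ.filter fun a => e a ∈ s).card := by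
  rw [Finset.card_filter, ← h.sum_eq (fun u => if u ∈ s then 1 else 0)]
  simp

/-- Removing one of two pendant vertices with a common neighbour. -/
lemma IsPendant.indepNum_eq_of_twin [Fintype V] [Fintype W] (h : IsPendant T T' e v x) {v' : V}
    (hne : v' ≠ v) (hv' : ∀ u, T.Adj v' u ↔ u = e x) : T.indepNum = T'.indepNum + 1 := by
  apply le_antisymm
  · obtain ⟨s, hs⟩ := T.exists_isNIndepSet_indepNum
    have h1 := h.card_eq_add_card_filter s
    have h2 := card_filter_range_le_indepNum e hs.1
    rw [← hs.2]
    split_ifs at h1 <;> omega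
  · obtain ⟨y, rfl⟩ := (h.ne_iff _).1 hne
    obtain ⟨s, hs⟩ := T'.exists_isNIndepSet_indepNum
    have hy : ∀ a, T'.Adj y a ↔ a = x := fun a => by
      rw [← e.map_adj_iff, hv', e.injective.eq_iff]
    -- Exchange: if a maximum independent set contains `x`, trade it for the leaf `y`, whose only
    -- neighbour is `x`.
    obtain ⟨s', hs', hc, hx⟩ : ∃ s' : Finset W, T'.IsIndepSet s' ∧ s'.card = T'.indepNum ∧
        x ∉ s' := by
      by_cases hxs : x ∈ s
      · refine ⟨insert y (s.erase x), isIndepSet_insert_of ?_ ?_, ?_, ?_⟩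
        · exact hs.1.mono (by simp)
        · intro u hu
          rw [hy]
          rintro rfl
          simp at hu
        · rw [Finset.card_insert_of_notMem, Finset.card_erase_add_one hxs, hs.2]
          intro hys
          have hxy := (hy x).2 rfl
          exact hs.1 (Finset.mem_of_mem_erase hys) hxs hxy.ne hxy
        · have hxy := (hy x).2 rfl
          simp [hxy.ne.symm]
      · exact ⟨s, hs.1, hs.2, hxs⟩
    have hi : T.IsIndepSet (insert v (s'.map e.toEmbedding) : Finset V) := by
      apply isIndepSet_insert_of (hs'.map_embedding e)
      intro u hu
      rw [h.adj_iff]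
      rintro rfl
      simp only [Finset.mem_map] at hu
      obtain ⟨a, ha, hae⟩ := hu
      rw [e.injective hae] at ha
      exact hx ha
    have := hi.card_le_indepNum
    rwa [Finset.card_insert_of_notMem, Finset.card_map, hc] at this
    simpa using fun a _ => h.apply_ne a

/-- Removing a pendant path with two vertices. -/
lemma IsPendant.indepNum_eq_of_path {U : Type*} [Fintype U] {T'' : SimpleGraph U}
    [Fintype V] [Fintype W] (h : IsPendant T T' e v x) {e' : T'' ↪g T'} {y : U}
    (h' : IsPendant T' T'' e' x y) : T.indepNum = T''.indepNum + 1 := by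
  have hvx : T.Adj v (e x) := (h.adj_iff _).2 rfl
  apply le_antisymm
  · obtain ⟨s, hs⟩ := T.exists_isNIndepSet_indepNum
    have h1 := h.card_eq_add_card_filter s
    have h2 : (Finset.univ.filter fun a => e a ∈ s).card = (if e x ∈ s then 1 else 0) +
        (Finset.univ.filter fun a => e (e' a) ∈ s).card := by
      rw [h'.card_eq_add_card_filter]
      congr 1
      · simp
      · simp
    have h3 : (Finset.univ.filter fun a => e (e' a) ∈ s).card ≤ T''.indepNum := by
      convert card_filter_range_le_indepNum (e'.trans e) hs.1
      rfl
    have h4 : ¬ (v ∈ s ∧ e x ∈ s) := fun hh => hs.1 hh.1 hh.2 hvx.ne hvx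
    rw [← hs.2]
    split_ifs at h1 h2
    · tauto
    all_goals omega
  · obtain ⟨s, hs⟩ := T''.exists_isNIndepSet_indepNum
    have hi : T.IsIndepSet (insert v (s.map (e'.trans e).toEmbedding) : Finset V) := by
      apply isIndepSet_insert_of (hs.1.map_embedding _)
      intro u hu
      rw [h.adj_iff]
      rintro rfl
      simp only [Finset.mem_map] at hu
      obtain ⟨a, ha, hae⟩ := hu
      exact h'.apply_ne a (e.injective hae)
    have := hi.card_le_indepNum
    rwa [Finset.card_insert_of_notMem, Finset.card_map, hs.2] at this
    simpa using fun a _ => h.apply_ne _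

lemma IsAcyclic.isIndepSet_neighborSet (hT : T.IsAcyclic) (c : V) :
    T.IsIndepSet (T.neighborSet c) := by
  intro a ha b hb _ hadj
  refine hT.cliqueFree (n := 3) le_rfl {c, a, b} ?_
  rw [is3Clique_iff]
  exact ⟨c, a, b, ha, hb, hadj, rfl⟩

lemma IsAcyclic.degree_le_indepNum [Fintype V] (hT : T.IsAcyclic) (c : V) :
    T.degree c ≤ T.indepNum := by
  rw [← card_neighborFinset_eq_degree]
  apply IsIndepSet.card_le_indepNum
  rw [coe_neighborFinset]
  exact hT.isIndepSet_neighborSet c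

/-! ### Spur centres and sums over distances -/

/-- The vertex `c` has degree `a`, and all vertices are within distance two of it. -/
def IsSpurCenter [Fintype V] (T : SimpleGraph V) (a : ℕ) (c : V) : Prop :=
  T.degree c = a ∧ ∀ u, T.dist c u ≤ 2

/-- Among connected graphs in which `c` has degree at most `a`, a sum of a decreasing function of
the distance to `c` is largest when `c` has degree `a` and eccentricity at most two. -/
lemma Connected.sum_dist_le [Fintype V] (hc : T.Connected) {g : ℕ → ℝ} (hg : StrictAnti g) {c : V}
    {a : ℕ} (ha : T.degree c ≤ a) :
    ∑ u, g (T.dist c u) ≤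
        Fintype.card V * g 2 + (g 0 - g 2) + a * (g 1 - g 2) ∧
      (∑ u, g (T.dist c u) = Fintype.card V * g 2 + (g 0 - g 2) + a * (g 1 - g 2) ↔
        T.IsSpurCenter a c) := by
  -- The majorant treats every distance of at least two as exactly two.
  set f : V → ℝ := fun u => g 2 + (if c = u then g 0 - g 2 else 0) +
    if T.Adj c u then g 1 - g 2 else 0 with hf
  have hf' : ∑ u, f u = Fintype.card V * g 2 + (g 0 - g 2) + T.degree c * (g 1 - g 2) := by
    simp only [hf, Finset.sum_add_distrib, Finset.sum_const, Finset.card_univ, nsmul_eq_mul,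
      Finset.sum_ite_eq, Finset.mem_univ, if_true]
    rw [← Finset.sum_filter, Finset.sum_const, ← neighborFinset_eq_filter,
      card_neighborFinset_eq_degree, nsmul_eq_mul]
  have hpt : ∀ u, g (T.dist c u) ≤ f u ∧ (g (T.dist c u) = f u ↔ T.dist c u ≤ 2) := by
    intro u
    by_cases hcu : c = u
    · subst hcu
      simp [hf]
    · have h0 := hc.pos_dist_of_ne hcu
      by_cases hadj : T.Adj c u
      · simp [hf, hcu, hadj, dist_eq_one_iff_adj.2 hadj]
      · have h1 : T.dist c u ≠ 1 := fun h => hadj (dist_eq_one_iff_adj.1 h)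
        simp only [hf, hcu, hadj, if_false, add_zero]
        refine ⟨hg.antitone (by omega), ?_⟩
        rw [hg.injective.eq_iff]
        omega
  have hle : ∑ u, g (T.dist c u) ≤ ∑ u, f u := Finset.sum_le_sum fun u _ => (hpt u).1
  have heq : ∑ u, g (T.dist c u) = ∑ u, f u ↔ ∀ u, T.dist c u ≤ 2 := by
    rw [Finset.sum_eq_sum_iff_of_le fun u _ => (hpt u).1]
    simp [hpt]
  have hg12 : 0 < g 1 - g 2 := sub_pos.2 (hg one_lt_two)
  have hda : (T.degree c : ℝ) ≤ a := by exact_mod_cast ha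
  have hmul : (T.degree c : ℝ) * (g 1 - g 2) ≤ a * (g 1 - g 2) :=
    mul_le_mul_of_nonneg_right hda hg12.le
  refine ⟨by linarith, fun h => ?_, fun h => ?_⟩
  · refine ⟨?_, heq.1 (by linarith)⟩
    have : (T.degree c : ℝ) * (g 1 - g 2) = a * (g 1 - g 2) := by linarith
    exact_mod_cast mul_right_cancel₀ hg12.ne' this
  · rw [heq.2 h.2, hf', h.1]

/-! ### Deepest vertices of a rooted tree -/

/-- In a tree rooted at `r` a vertex has only one neighbour closer to `r`. -/
lemma IsTree.eq_of_adj_of_dist_lt (hT : T.IsTree) {r u a b : V} (ha : T.Adj u a) (hb : T.Adj u b)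
    (hda : T.dist r a < T.dist r u) (hdb : T.dist r b < T.dist r u) : a = b := by
  have key : ∀ y, T.Adj u y → T.dist r y < T.dist r u →
      ∃ p : T.Walk r u, p.IsPath ∧ p.penultimate = y := by
    intro y hy hd
    obtain ⟨p, hp⟩ := hT.connected.exists_walk_length_eq_dist r y
    refine ⟨p.concat hy.symm, Walk.isPath_of_length_eq_dist _ ?_, by simp⟩
    rw [Walk.length_concat, hp]
    rcases hT.dist_eq_dist_add_one_of_adj r hy with h | h <;> omega
  obtain ⟨p, hp, rfl⟩ := key a ha hda
  obtain ⟨q, hq, rfl⟩ := key b hb hdb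
  have := (hT.isAcyclic.subsingleton_path r u).elim ⟨p, hp⟩ ⟨q, hq⟩
  simp only [Subtype.mk.injEq] at this
  rw [this]

lemma Connected.exists_adj_dist_eq (hT : T.Connected) {r v : V} (h : v ≠ r) :
    ∃ w, T.Adj v w ∧ T.dist r v = T.dist r w + 1 := by
  obtain ⟨p, hp⟩ := hT.exists_walk_length_eq_dist v r
  cases p with
  | nil => exact absurd rfl h
  | @cons _ w _ hadj p =>
    refine ⟨w, hadj, ?_⟩
    have h1 := dist_le p
    have h2 := hT.dist_triangle (u := v) (v := w) (w := r)
    rw [dist_eq_one_iff_adj.2 hadj] at h2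
    rw [Walk.length_cons] at hp
    rw [dist_comm (u := r), dist_comm (u := r)]
    omega

/-- A rooted tree either consists of a single edge, or has two pendant vertices with a common
neighbour, or has a pendant path with two vertices that avoids the root. -/
lemma IsTree.exists_pendant [Fintype V] [Nontrivial V] (hT : T.IsTree) (r : V) :
    ∃ v w, v ≠ r ∧ (∀ u, T.Adj v u ↔ u = w) ∧
      ((∃ v', v' ≠ v ∧ ∀ u, T.Adj v' u ↔ u = w) ∨
       (w ≠ r ∧ ∃ x, x ≠ v ∧ (∀ u, T.Adj w u ↔ u = v ∨ u = x) ∧ ∃ y, y ≠ w ∧ T.Adj x y) ∨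
       ∀ u, u = v ∨ u = w) := by
  have hc := hT.connected
  obtain ⟨v, hv⟩ := Finite.exists_max (T.dist r)
  have hvr : v ≠ r := by
    rintro rfl
    obtain ⟨y, hy⟩ := exists_ne v
    have := hc.pos_dist_of_ne hy.symm
    have := hv y
    rw [dist_self] at this
    omega
  -- Vertices on the deepest level have only closer neighbours, hence exactly one.
  have leaf : ∀ {a w}, T.dist r a = T.dist r v → T.Adj a w → ∀ u, T.Adj a u ↔ u = w := by
    intro a w ha haw u
    have hlt : ∀ y, T.Adj a y → T.dist r y < T.dist r a := fun y hy => by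
      have := hT.dist_ne_of_adj r hy
      have := hv y
      omega
    refine ⟨fun hu => hT.eq_of_adj_of_dist_lt hu haw (hlt u hu) (hlt w haw), ?_⟩
    rintro rfl
    exact haw
  obtain ⟨w, hvw, hdw⟩ := hc.exists_adj_dist_eq hvr
  refine ⟨v, w, hvr, leaf rfl hvw, ?_⟩
  by_cases htwin : ∃ v', v' ≠ v ∧ ∀ u, T.Adj v' u ↔ u = w
  · exact Or.inl htwin
  right
  by_cases hwr : w = r
  · right
    intro u
    by_contra! hu
    have h1 := hv u
    have h2 := hc.pos_dist_of_ne (hwr ▸ hu.2 : u ≠ r).symm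
    rw [hwr, dist_self] at hdw
    have h3 : T.dist r u = 1 := by omega
    refine htwin ⟨u, hu.1, leaf (h3.trans (by omega)) ?_⟩
    rw [hwr]
    exact (dist_eq_one_iff_adj.1 h3).symm
  · left
    obtain ⟨x, hwx, hdx⟩ := hc.exists_adj_dist_eq hwr
    have hxv : x ≠ v := by rintro rfl; omega
    refine ⟨hwr, x, hxv, fun u => ⟨fun hu => ?_, ?_⟩, ?_⟩
    · by_contra! hne
      apply htwin ⟨u, hne.1, leaf ?_ hu.symm⟩
      rcases hT.dist_eq_dist_add_one_of_adj r hu with h | h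
      · exact absurd (hT.eq_of_adj_of_dist_lt (r := r) hu hwx (by omega) (by omega)) hne.2
      · omega
    · rintro (rfl | rfl)
      · exact hvw.symm
      · exact hwx
    -- Otherwise `x` would itself be a leaf at `w`, a twin of `v`.
    · by_contra! hy
      refine htwin ⟨x, hxv, fun u => ⟨fun h => ?_, ?_⟩⟩
      · by_contra hne
        exact hy u hne h
      · rintro rfl
        exact hwx.symm

end
end SimpleGraph

namespace SimpleGraph

/-! ### Increments of the index and of the bound -/

section
open scoped Classical

/-- The Harary index of the spur `A_{n,a}`. -/
noncomputable def spurBound (n a : ℕ) : ℝ :=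
  (3 * (n : ℝ) ^ 2 + 2 * (a : ℝ) * (n : ℝ) + (a : ℝ) ^ 2 - 9 * (a : ℝ) + 19 * (n : ℝ) - 22) / 24

lemma strictAnti_inv_add_one : StrictAnti fun k : ℕ => ((k : ℝ) + 1)⁻¹ :=
  fun a b hab => inv_strictAnti₀ (by positivity) (by exact_mod_cast Nat.succ_lt_succ hab)

/-- These are the contributions of the two vertices of a pendant path, as a function of the distance
to its attachment vertex. -/
lemma strictAnti_inv_add_one_add_inv_add_two :
    StrictAnti fun k : ℕ => ((k : ℝ) + 1)⁻¹ + ((k : ℝ) + 2)⁻¹ :=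
  strictAnti_inv_add_one.add fun a b hab =>
    inv_strictAnti₀ (by positivity) (by
      have : (a : ℝ) < b := by exact_mod_cast hab
      linarith)

section
variable {V W U : Type*} [Fintype V] [Fintype W] [Fintype U]
  {T : SimpleGraph V} {T' : SimpleGraph W} {T'' : SimpleGraph U}
  {e : T' ↪g T} {v : V} {x : W} {e' : T'' ↪g T'} {y : U}

lemma IsPendant.hararyIndex_sub_le_of_twin (h : IsPendant T T' e v x) (hT' : T'.IsTree)
    {v' : V} (hne : v' ≠ v) (hv' : ∀ u, T.Adj v' u ↔ u = e x) :
    hararyIndex T - hararyIndex T' ≤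
        spurBound (Fintype.card V) T.indepNum - spurBound (Fintype.card W) T'.indepNum ∧
      (hararyIndex T - hararyIndex T' =
        spurBound (Fintype.card V) T.indepNum - spurBound (Fintype.card W) T'.indepNum ↔
        T'.IsSpurCenter T'.indepNum x) := by
  have key := hT'.connected.sum_dist_le strictAnti_inv_add_one
    (hT'.isAcyclic.degree_le_indepNum x)
  have hb : spurBound (Fintype.card V) T.indepNum - spurBound (Fintype.card W) T'.indepNum =
      Fintype.card W * (((2 : ℕ) : ℝ) + 1)⁻¹ +
        ((((0 : ℕ) : ℝ) + 1)⁻¹ - (((2 : ℕ) : ℝ) + 1)⁻¹) +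
        T'.indepNum * ((((1 : ℕ) : ℝ) + 1)⁻¹ - (((2 : ℕ) : ℝ) + 1)⁻¹) := by
    rw [h.card_eq, h.indepNum_eq_of_twin hne hv']
    unfold spurBound
    push_cast
    ring
  rw [h.hararyIndex_eq hT'.connected, add_sub_cancel_left, hb]
  exact key

lemma IsPendant.hararyIndex_sub_le_of_path (h : IsPendant T T' e v x) (hT' : T'.IsTree)
    (h' : IsPendant T' T'' e' x y) (hT'' : T''.IsTree) :
    hararyIndex T - hararyIndex T'' ≤
        spurBound (Fintype.card V) T.indepNum - spurBound (Fintype.card U) T''.indepNum ∧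
      (hararyIndex T - hararyIndex T'' =
        spurBound (Fintype.card V) T.indepNum - spurBound (Fintype.card U) T''.indepNum ↔
        T''.IsSpurCenter T''.indepNum y) := by
  have key := hT''.connected.sum_dist_le strictAnti_inv_add_one_add_inv_add_two
    (hT''.isAcyclic.degree_le_indepNum y)
  set B : ℝ := Fintype.card U * ((((2 : ℕ) : ℝ) + 1)⁻¹ + (((2 : ℕ) : ℝ) + 2)⁻¹) +
        ((((0 : ℕ) : ℝ) + 1)⁻¹ + (((0 : ℕ) : ℝ) + 2)⁻¹ -
          ((((2 : ℕ) : ℝ) + 1)⁻¹ + (((2 : ℕ) : ℝ) + 2)⁻¹)) +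
        T''.indepNum * ((((1 : ℕ) : ℝ) + 1)⁻¹ + (((1 : ℕ) : ℝ) + 2)⁻¹ -
          ((((2 : ℕ) : ℝ) + 1)⁻¹ + (((2 : ℕ) : ℝ) + 2)⁻¹)) with hB
  have hb : spurBound (Fintype.card V) T.indepNum - spurBound (Fintype.card U) T''.indepNum =
      B + 1 := by
    rw [h.card_eq, h'.card_eq, h.indepNum_eq_of_path h', hB]
    unfold spurBound
    push_cast
    ring
  have hs : hararyIndex T - hararyIndex T'' =
      ∑ u, (((T''.dist y u : ℝ) + 1)⁻¹ + ((T''.dist y u : ℝ) + 2)⁻¹) + 1 := by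
    rw [h.hararyIndex_eq hT'.connected, h'.hararyIndex_eq hT''.connected, h'.sum_eq,
      Finset.sum_add_distrib]
    simp only [h'.dist_left hT''.connected, dist_self]
    push_cast
    simp only [add_assoc, one_add_one_eq_two]
    ring
  rw [hb, hs]
  exact ⟨by linarith [key.1], by rw [add_left_inj]; exact key.2⟩

/-- Degree and independence number both change by one, and the deleted leaf is adjacent to the
centre. -/
lemma IsPendant.isSpurCenter_of_twin (h : IsPendant T T' e v x) (hc : T'.Connected) {v' : V}
    (hne : v' ≠ v) (hv' : ∀ u, T.Adj v' u ↔ u = e x) :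
    T.IsSpurCenter T.indepNum (e x) ↔ T'.IsSpurCenter T'.indepNum x := by
  unfold IsSpurCenter
  rw [h.indepNum_eq_of_twin hne hv', h.degree_eq, if_pos rfl, Nat.add_right_cancel_iff]
  refine and_congr_right fun _ => ⟨fun H u => ?_, fun H u => ?_⟩
  · rw [← h.dist_apply hc]
    exact H _
  · by_cases hu : u = v
    · subst hu
      rw [dist_comm, h.dist_left hc, dist_self]
      omega
    · obtain ⟨a, rfl⟩ := (h.ne_iff u).1 hu
      rw [h.dist_apply hc]
      exact H _

lemma IsPendant.isSpurCenter_of_path (h : IsPendant T T' e v x) (hT' : T'.IsTree)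
    (h' : IsPendant T' T'' e' x y) (hT'' : T''.IsTree) :
    T.IsSpurCenter T.indepNum (e (e' y)) ↔ T''.IsSpurCenter T''.indepNum y := by
  unfold IsSpurCenter
  rw [h.indepNum_eq_of_path h', h.degree_eq, if_neg (h'.apply_ne y), h'.degree_eq, if_pos rfl,
    add_zero, Nat.add_right_cancel_iff]
  refine and_congr_right fun _ => ⟨fun H u => ?_, fun H u => ?_⟩
  · rw [← h'.dist_apply hT''.connected, ← h.dist_apply hT'.connected]
    exact H _
  · by_cases hu : u = v
    · subst hu
      rw [dist_comm, h.dist_left hT'.connected, h'.dist_left hT''.connected, dist_self]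
    · obtain ⟨a, rfl⟩ := (h.ne_iff u).1 hu
      rw [h.dist_apply hT'.connected]
      by_cases ha : a = x
      · subst ha
        rw [dist_comm, h'.dist_left hT''.connected, dist_self]
        omega
      · obtain ⟨b, rfl⟩ := (h'.ne_iff a).1 ha
        rw [h'.dist_apply hT''.connected]
        exact H _

/-- If `w ≠ c`, the twins together with the neighbours of `c` other than `w` form an independent set
that is too large. -/
lemma IsAcyclic.eq_of_twin_of_degree_eq (hT : T.IsAcyclic) {v' w c : V} (hne : v' ≠ v)
    (hv : ∀ u, T.Adj v u ↔ u = w) (hv' : ∀ u, T.Adj v' u ↔ u = w)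
    (hd : T.degree c = T.indepNum) : w = c := by
  by_contra hwc
  have hi : T.IsIndepSet (insert v (insert v' ((T.neighborFinset c).erase w)) : Finset V) := by
    apply isIndepSet_insert_of
    · apply isIndepSet_insert_of
      · refine (hT.isIndepSet_neighborSet c).mono fun u hu => ?_
        simp only [Finset.coe_erase, coe_neighborFinset] at hu
        exact hu.1
      · intro u hu
        rw [hv']
        exact Finset.ne_of_mem_erase hu
    · intro u hu
      rw [hv]
      rcases Finset.mem_insert.1 hu with rfl | hu
      · exact ((hv' w).2 rfl).ne
      · exact Finset.ne_of_mem_erase hu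
  have hcard := hi.card_le_indepNum
  have h1 := Finset.pred_card_le_card_erase (s := T.neighborFinset c) (a := w)
  rw [Finset.card_insert_of_notMem, Finset.card_insert_of_notMem] at hcard
  · rw [card_neighborFinset_eq_degree] at h1
    omega
  · simp [T.adj_comm c, hv', Ne.symm hwc]
  · simp [T.adj_comm c, hv, Ne.symm hwc, hne.symm]

end

/-- The root serves the last clause: rooting at a spur centre keeps it among the remaining vertices
and makes it the attachment vertex. -/
lemma IsTree.hararyIndex_le_aux (n : ℕ) : ∀ (V : Type u) [Fintype V] (T : SimpleGraph V),
    T.IsTree → 2 ≤ n → Fintype.card V = n → ∀ r : V,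
      hararyIndex T ≤ spurBound n T.indepNum ∧
      (hararyIndex T = spurBound n T.indepNum → ∃ c, T.IsSpurCenter T.indepNum c) ∧
      (T.IsSpurCenter T.indepNum r → hararyIndex T = spurBound n T.indepNum) := by
  induction n using Nat.strong_induction_on with
  | _ n ih =>
  intro V _ T hT hn hV r
  have : Nontrivial V := Fintype.one_lt_card_iff_nontrivial.1 (by omega)
  obtain ⟨v, w, hvr, hv, hcase⟩ := hT.exists_pendant r
  obtain ⟨W, _, T', e, x, hP, rfl, hT'⟩ := exists_isPendant hT hv
  have hcardW := hP.card_eq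
  rcases hcase with ⟨v', hne, hv'⟩ | ⟨hwr, z, hzv, hw, y', hy', hzy'⟩ | hedge
  · have hstep := hP.hararyIndex_sub_le_of_twin hT' hne hv'
    -- The induction cannot descend to one vertex, where the index 0 exceeds the bound -1/4.
    have hW2 : 2 ≤ Fintype.card W := by
      obtain ⟨a, ha⟩ := (hP.ne_iff v').1 hne
      have : a ≠ x := by
        rintro rfl
        have := (hv' (e a)).2 rfl
        rw [ha] at this
        exact this.ne rfl
      have : Nontrivial W := ⟨a, x, this⟩
      exact Fintype.one_lt_card
    have hIH := ih (Fintype.card W) (by omega) W T' hT' hW2 rfl x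
    rw [hV] at hstep
    refine ⟨by linarith [hstep.1, hIH.1], fun h => ⟨e x, ?_⟩, fun h => ?_⟩
    · rw [hP.isSpurCenter_of_twin hT'.connected hne hv', ← hstep.2]
      linarith [hstep.1, hIH.1]
    · obtain rfl := hT.isAcyclic.eq_of_twin_of_degree_eq hne hv hv' h.1
      rw [hP.isSpurCenter_of_twin hT'.connected hne hv'] at h
      linarith [hIH.2.2 h, hstep.2.2 h]
  · have hzx : z ≠ e x := ((hw z).2 (Or.inr rfl)).ne.symm
    obtain ⟨z, rfl⟩ := (hP.ne_iff z).1 hzv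
    have hx : ∀ u, T'.Adj x u ↔ u = z := fun u => by
      rw [← e.map_adj_iff, hw, e.injective.eq_iff, or_iff_right (hP.apply_ne u)]
    obtain ⟨U, _, T'', e', y, hP', rfl, hT''⟩ := exists_isPendant hT' hx
    have hstep := hP.hararyIndex_sub_le_of_path hT' hP' hT''
    have hcardU := hP'.card_eq
    have hU2 : 2 ≤ Fintype.card U := by
      have hyv : y' ≠ v := by
        rintro rfl
        exact hzx ((hv _).1 hzy'.symm)
      obtain ⟨a, rfl⟩ := (hP.ne_iff y').1 hyv
      obtain ⟨b, rfl⟩ := (hP'.ne_iff a).1 (fun h => hy' (h ▸ rfl))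
      have : Nontrivial U := ⟨b, y, by rintro rfl; exact hzy'.ne rfl⟩
      exact Fintype.one_lt_card
    have hIH := ih (Fintype.card U) (by omega) U T'' hT'' hU2 rfl y
    rw [hV] at hstep
    refine ⟨by linarith [hstep.1, hIH.1], fun h => ⟨e (e' y), ?_⟩, fun h => ?_⟩
    · rw [hP.isSpurCenter_of_path hT' hP' hT'', ← hstep.2]
      linarith [hstep.1, hIH.1]
    -- The root is within distance two of `v` and is neither `v` nor its neighbour, so it is the far
    -- neighbour of that neighbour.
    · obtain rfl : r = e (e' y) := by
        obtain ⟨a, rfl⟩ := (hP.ne_iff r).1 hvr.symm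
        have h2 := h.2 v
        rw [dist_comm, hP.dist_left hT'.connected] at h2
        have h3 := hT'.connected.pos_dist_of_ne (u := x) (v := a) (fun h => hwr (h ▸ rfl))
        have h4 : T'.dist x a = 1 := by omega
        rw [(hx a).1 (dist_eq_one_iff_adj.1 h4)]
      rw [hP.isSpurCenter_of_path hT' hP' hT''] at h
      linarith [hIH.2.2 h, hstep.2.2 h]
  · have hW : ∀ a : W, a = x := fun a =>
      e.injective ((hedge (e a)).resolve_left (hP.apply_ne a))
    have : Unique W := ⟨⟨x⟩, hW⟩
    have hW1 : Fintype.card W = 1 := Fintype.card_unique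
    have hH : hararyIndex T = 1 := by
      rw [hP.hararyIndex_eq hT'.connected]
      simp [hararyIndex, Subsingleton.elim _ x]
    have hd : T.degree (e x) = 1 := by
      rw [hP.degree_eq, if_pos rfl, add_eq_right, ← card_neighborFinset_eq_degree,
        Finset.card_eq_zero, Finset.eq_empty_iff_forall_notMem]
      intro a ha
      rw [mem_neighborFinset, hW a] at ha
      exact ha.ne rfl
    have ha1 : T.indepNum = 1 := by
      apply le_antisymm _ (hd ▸ hT.isAcyclic.degree_le_indepNum _)
      obtain ⟨s, hs⟩ := T.exists_isNIndepSet_indepNum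
      rw [← hs.2, Finset.card_le_one]
      intro a ha b hb
      by_contra hab
      have hvx : T.Adj v (e x) := (hv _).2 rfl
      have hnot := hs.1 ha hb hab
      rcases hedge a with rfl | rfl <;> rcases hedge b with rfl | rfl
      · exact hab rfl
      · exact hnot hvx
      · exact hnot hvx.symm
      · exact hab rfl
    have hb : spurBound n T.indepNum = 1 := by
      rw [ha1, ← hV, hcardW, hW1]
      norm_num [spurBound]
    rw [hH, hb]
    refine ⟨le_rfl, fun _ => ⟨e x, hd.trans ha1.symm, fun u => ?_⟩, fun _ => rfl⟩
    rcases hedge u with rfl | rfl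
    · rw [dist_comm, hP.dist_left hT'.connected, dist_self]
      omega
    · rw [dist_self]
      omega

/-- A tree on `n ≥ 2` vertices has Harary index at most `spurBound n α`, with equality if and only
if some vertex of degree `α` is within distance two of all others. -/
lemma IsTree.hararyIndex_le {V : Type*} [Fintype V] {T : SimpleGraph V} (hT : T.IsTree)
    (hV : 2 ≤ Fintype.card V) :
    hararyIndex T ≤ spurBound (Fintype.card V) T.indepNum ∧
      (hararyIndex T = spurBound (Fintype.card V) T.indepNum ↔
        ∃ c, T.IsSpurCenter T.indepNum c) := by
  have h := hararyIndex_le_aux _ V T hT hV rfl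
  have := hT.connected.nonempty
  exact ⟨(h this.some).1, (h this.some).2.1, fun ⟨c, hc⟩ => (h c).2.2 hc⟩

end
end SimpleGraph

namespace SimpleGraph

/-! ### Spur centres characterise the spur -/

section
open scoped Classical
variable {V : Type*} [Fintype V] {T : SimpleGraph V}

/-- `j` is a child of `i` in the spur with `m` branches. -/
def SpurRel (m i j : ℕ) : Prop := (i = 0 ∧ 1 ≤ j ∧ j ≤ m) ∨ (1 ≤ i ∧ j = m + i)

lemma spur_adj {n m : ℕ} {i j : Fin n} :
    (spur n m).Adj i j ↔ i ≠ j ∧ (SpurRel m i j ∨ SpurRel m j i) := by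
  simp only [spur, fromRel_adj, SpurRel]

/-- Relabelling a finset by an initial segment while sending a subset to a shorter initial
segment. -/
lemma exists_injOn_Icc {V : Type*} (N P : Finset V) (hP : P ⊆ N) :
    ∃ l : V → ℕ, (∀ u ∈ N, 1 ≤ l u ∧ l u ≤ N.card) ∧ Set.InjOn l N ∧
      ∀ u ∈ P, l u ≤ P.card := by
  obtain ⟨g, hg⟩ := Finset.exists_equiv_extend_of_card_eq (α := N) (t := Finset.Icc 1 N.card)
    (by simp) (s := Finset.univ.filter fun u => (u : V) ∈ P)
    (f := fun u => if h : (u : V) ∈ P then (P.equivFin ⟨u, h⟩ : ℕ) + 1 else 0) (by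
      intro i hi
      obtain ⟨u, hu, rfl⟩ := Finset.mem_image.1 hi
      have hu := (Finset.mem_filter.1 hu).2
      have h1 := (P.equivFin ⟨u, hu⟩).2
      have h2 := Finset.card_le_card hP
      simp only [dif_pos hu, Finset.mem_Icc]
      omega) (by
      intro u hu u' hu' h
      have hu := (Finset.mem_filter.1 hu).2
      have hu' := (Finset.mem_filter.1 hu').2
      simp only [dif_pos hu, dif_pos hu'] at h
      have := P.equivFin.injective (Fin.ext (Nat.succ_injective h))
      exact Subtype.ext (Subtype.mk.inj this))
  refine ⟨fun u => if h : u ∈ N then g ⟨u, h⟩ else 0, fun u hu => ?_, fun u hu u' hu' h => ?_,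
    fun u hu => ?_⟩
  · simp only [dif_pos hu]
    exact Finset.mem_Icc.1 (g ⟨u, hu⟩).2
  · simp only [dif_pos (Finset.mem_coe.1 hu), dif_pos (Finset.mem_coe.1 hu')] at h
    simpa using g.injective (Subtype.ext h)
  · have h1 := hg ⟨u, hP hu⟩ (by simpa using hu)
    simp only [dif_pos (hP hu)]
    simp only [dif_pos hu] at h1
    rw [h1]
    exact (P.equivFin ⟨u, hu⟩).2

/-- Maximality of the independence number makes the parent map `p` injective on the vertices at
distance two; numbering the parents first among the neighbours of `c` then gives the spur labelling.
-/
lemma IsTree.nonempty_iso_spur (hT : T.IsTree) {c : V} (hc : T.IsSpurCenter T.indepNum c) :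
    Nonempty (T ≃g spur (Fintype.card V) T.indepNum) := by
  obtain ⟨hdeg, hdist⟩ := hc
  have hex : ∀ u, ∃ w, T.dist c u = 2 → T.Adj u w ∧ T.Adj c w := fun u => by
    by_cases hu : T.dist c u = 2
    · obtain ⟨w, h1, h2⟩ := hT.connected.exists_adj_dist_eq (r := c) (v := u)
        (by rintro rfl; rw [dist_self] at hu; omega)
      exact ⟨w, fun _ => ⟨h1, dist_eq_one_iff_adj.1 (by omega)⟩⟩
    · exact ⟨c, fun h => absurd h hu⟩
  choose p hp using hex
  have hpar : ∀ {u w}, T.dist c u = 2 → T.Adj u w → T.Adj c w → w = p u := by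
    intro u w hu huw hcw
    have h1 := dist_eq_one_iff_adj.2 hcw
    have h2 := dist_eq_one_iff_adj.2 (hp u hu).2
    exact hT.eq_of_adj_of_dist_lt (r := c) huw (hp u hu).1 (by omega) (by omega)
  set m := T.indepNum with hm
  set L : Finset V := Finset.univ.filter fun u => T.dist c u = 2 with hL
  have hmemL : ∀ {u}, u ∈ L ↔ T.dist c u = 2 := by simp [hL]
  have hpinj : Set.InjOn p L := by
    intro u hu u' hu' h
    by_contra hne
    have hu := hmemL.1 hu
    have hu' := hmemL.1 hu'
    -- Replacing the shared parent by its two children in the neighbourhood of `c` would give `m +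
    -- 1` independent vertices.
    have hi : T.IsIndepSet
        (insert u (insert u' ((T.neighborFinset c).erase (p u))) : Finset V) := by
      apply isIndepSet_insert_of
      · apply isIndepSet_insert_of
        · refine (hT.isAcyclic.isIndepSet_neighborSet c).mono fun u hu => ?_
          simp only [Finset.coe_erase, coe_neighborFinset] at hu
          exact hu.1
        · intro y hy hadj
          rw [Finset.mem_erase, mem_neighborFinset, h] at hy
          exact hy.1 (hpar hu' hadj hy.2)
      · intro y hy hadj
        rcases Finset.mem_insert.1 hy with rfl | hy
        · exact hT.dist_ne_of_adj c hadj (hu.trans hu'.symm)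
        · rw [Finset.mem_erase, mem_neighborFinset] at hy
          exact hy.1 (hpar hu hadj hy.2)
    have hcard := hi.card_le_indepNum
    have h1 := Finset.pred_card_le_card_erase (s := T.neighborFinset c) (a := p u)
    have hnot : ∀ {y}, T.dist c y = 2 → ¬ T.Adj c y := fun h2 h1 => by
      rw [dist_eq_one_iff_adj.2 h1] at h2
      omega
    rw [Finset.card_insert_of_notMem, Finset.card_insert_of_notMem] at hcard
    · rw [card_neighborFinset_eq_degree] at h1
      omega
    · simp [hnot hu']
    · simp [hnot hu, hne]
  obtain ⟨l, hl, hlinj, hlP⟩ := exists_injOn_Icc (T.neighborFinset c) (L.image p) (by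
    intro w hw
    obtain ⟨u, hu, rfl⟩ := Finset.mem_image.1 hw
    rw [mem_neighborFinset]
    exact (hp u (hmemL.1 hu)).2)
  simp only [mem_neighborFinset, card_neighborFinset_eq_degree, hdeg] at hl
  rw [Finset.card_image_of_injOn hpinj] at hlP
  have hlinj : ∀ {u u'}, T.Adj c u → T.Adj c u' → l u = l u' → u = u' := fun h h' =>
    hlinj (by simpa using h) (by simpa using h')
  have hlP : ∀ {u}, T.dist c u = 2 → l (p u) ≤ L.card := fun h =>
    hlP _ (Finset.mem_image_of_mem _ (hmemL.2 h))
  have hclass : ∀ u, u = c ∨ T.Adj c u ∨ T.dist c u = 2 := fun u => by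
    by_cases hu : u = c
    · exact Or.inl hu
    · have h1 := hdist u
      have h2 := hT.connected.pos_dist_of_ne (Ne.symm hu)
      rw [← dist_eq_one_iff_adj]
      omega
  have hcard : Fintype.card V = 1 + m + L.card := by
    have : (Finset.univ : Finset V) = insert c (T.neighborFinset c ∪ L) := by
      ext u
      simpa [hmemL] using hclass u
    rw [← Finset.card_univ, this, Finset.card_insert_of_notMem, Finset.card_union_of_disjoint,
      card_neighborFinset_eq_degree, hdeg]
    · ring
    · rw [Finset.disjoint_left]
      intro u hu hu'
      rw [mem_neighborFinset, ← dist_eq_one_iff_adj] at hu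
      rw [hmemL] at hu'
      omega
    · simp [hmemL]
  set F : V → ℕ := fun u => if u = c then 0 else if T.Adj c u then l u else m + l (p u) with hF
  have hF0 : F c = 0 := by simp [hF]
  have hF1 : ∀ {u}, T.Adj c u → F u = l u := fun h => by simp [hF, h, h.ne.symm]
  have hF2 : ∀ {u}, T.dist c u = 2 → F u = m + l (p u) := fun {u} h => by
    have h1 : u ≠ c := by rintro rfl; rw [dist_self] at h; omega
    have h2 : ¬ T.Adj c u := by rw [← dist_eq_one_iff_adj]; omega
    simp [hF, h1, h2]
  have hlp : ∀ {u}, T.dist c u = 2 → 1 ≤ l (p u) ∧ l (p u) ≤ m := fun h => hl _ (hp _ h).2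
  -- Parents carry labels at most `L.card`, so labels of their children stay below `1 + m + L.card`.
  have hFlt : ∀ u, F u < Fintype.card V := fun u => by
    rcases hclass u with rfl | h | h
    · omega
    · have := hl u h
      rw [hF1 h]
      omega
    · have := hlP h
      rw [hF2 h]
      omega
  have hFinj : Function.Injective F := by
    intro u u' h
    rcases hclass u with rfl | hu | hu <;> rcases hclass u' with rfl | hu' | hu'
    · rfl
    · have := hl u' hu'
      rw [hF0, hF1 hu'] at h
      omega
    · have := hlp hu'
      rw [hF0, hF2 hu'] at h
      omega
    · have := hl u hu
      rw [hF0, hF1 hu] at h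
      omega
    · rw [hF1 hu, hF1 hu'] at h
      exact hlinj hu hu' h
    · have := hl u hu
      have := hlp hu'
      rw [hF1 hu, hF2 hu'] at h
      omega
    · have := hlp hu
      rw [hF0, hF2 hu] at h
      omega
    · have := hl u' hu'
      have := hlp hu
      rw [hF2 hu, hF1 hu'] at h
      omega
    · rw [hF2 hu, hF2 hu'] at h
      exact hpinj (hmemL.2 hu) (hmemL.2 hu')
        (hlinj (hp _ hu).2 (hp _ hu').2 (Nat.add_left_cancel h))
  have hrel : ∀ {u v}, SpurRel m (F u) (F v) → T.Adj u v := by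
    rintro u v (⟨h0, h1, h2⟩ | ⟨h1, h2⟩)
    · obtain rfl : u = c := hFinj (h0.trans hF0.symm)
      rcases hclass v with rfl | h | h
      · omega
      · exact h
      · have := hlp h
        rw [hF2 h] at h2
        omega
    · rcases hclass v with rfl | h | h
      · omega
      · have := hl v h
        rw [hF1 h] at h2
        omega
      · rw [hF2 h] at h2
        have := hlp h
        rcases hclass u with rfl | h' | h'
        · omega
        · rw [hF1 h'] at h2
          rw [hlinj h' (hp _ h).2 (by omega)]
          exact (hp _ h).1.symm
        · have := hlp h'
          rw [hF2 h'] at h2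
          omega
  have hadj : ∀ {u v}, T.Adj u v → T.dist c v = T.dist c u + 1 → SpurRel m (F u) (F v) := by
    intro u v huv hd
    rcases hclass v with rfl | h | h
    · rw [dist_self] at hd
      omega
    · rw [dist_eq_one_iff_adj.2 h] at hd
      obtain rfl : c = u := hT.connected.dist_eq_zero_iff.1 (by omega)
      left
      rw [hF0, hF1 h]
      exact ⟨rfl, hl v h⟩
    · have hcu : T.Adj c u := dist_eq_one_iff_adj.1 (by omega)
      right
      rw [hF1 hcu, hF2 h, ← hpar h huv.symm hcu]
      exact ⟨(hl u hcu).1, rfl⟩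
  have hbij : Function.Bijective fun u => (⟨F u, hFlt u⟩ : Fin (Fintype.card V)) := by
    rw [Fintype.bijective_iff_injective_and_card]
    exact ⟨fun u u' h => hFinj (Fin.mk.inj h), by simp⟩
  refine ⟨⟨Equiv.ofBijective _ hbij, ?_⟩⟩
  intro u v
  rw [spur_adj]
  refine ⟨fun h => h.2.elim hrel fun h => (hrel h).symm, fun h => ⟨?_, ?_⟩⟩
  · exact (Equiv.ofBijective _ hbij).injective.ne h.ne
  · rcases hT.dist_eq_dist_add_one_of_adj c h with hd | hd
    · exact Or.inr (hadj h.symm hd)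
    · exact Or.inl (hadj h hd)

/-- One of the two colour classes holds at least half the vertices. In the spur this guarantees that
a label above `m` has its parent among `1, …, m`. -/
lemma IsTree.card_le_two_mul_indepNum (hT : T.IsTree) : Fintype.card V ≤ 2 * T.indepNum := by
  obtain ⟨C⟩ := hT.colorable_two
  have h : ∀ i : Fin 2, (Finset.univ.filter fun u => C u = i).card ≤ T.indepNum := fun i => by
    apply IsIndepSet.card_le_indepNum
    intro a ha b hb _ hadj
    simp only [Finset.coe_filter, Finset.mem_univ, true_and, Set.mem_ofPred_eq] at ha hb
    exact C.valid hadj (ha.trans hb.symm)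
  have h1 := Finset.card_eq_sum_card_fiberwise (s := Finset.univ) (t := Finset.univ)
    (f := C) (fun _ _ => Finset.mem_coe.2 (Finset.mem_univ _))
  rw [Fin.sum_univ_two, Finset.card_univ] at h1
  have := h 0
  have := h 1
  omega

lemma Connected.indepNum_lt_card [Nontrivial V] (hT : T.Connected) :
    T.indepNum < Fintype.card V := by
  obtain ⟨s, hs⟩ := T.exists_isNIndepSet_indepNum
  rw [← hs.2]
  obtain ⟨u, v, hne⟩ := exists_pair_ne V
  obtain ⟨w, hw, -⟩ := hT.exists_adj_dist_eq hne
  by_cases hu : u ∈ s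
  · exact Finset.card_lt_univ_of_notMem fun hws => hs.1 hu hws hw.ne hw
  · exact Finset.card_lt_univ_of_notMem hu

lemma IsTree.exists_isSpurCenter_of_iso [Nontrivial V] (hT : T.IsTree)
    (φ : T ≃g spur (Fintype.card V) T.indepNum) : ∃ c, T.IsSpurCenter T.indepNum c := by
  have hlt := hT.connected.indepNum_lt_card
  have hle := hT.card_le_two_mul_indepNum
  set m := T.indepNum
  set z : Fin (Fintype.card V) := ⟨0, Fintype.card_pos⟩
  have hadj : ∀ u, T.Adj (φ.symm z) u ↔ 1 ≤ (φ u : ℕ) ∧ (φ u : ℕ) ≤ m := fun u => by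
    rw [← φ.map_adj_iff, RelIso.apply_symm_apply, spur_adj, Fin.ne_iff_vne]
    have hz0 : (z : ℕ) = 0 := rfl
    simp only [SpurRel, hz0, true_and]
    omega
  refine ⟨φ.symm z, ?_, fun u => ?_⟩
  · rw [← card_neighborFinset_eq_degree]
    refine Eq.trans (b := (Finset.Icc 1 m).card) ?_ (by simp)
    refine Finset.card_bij' (fun u _ => (φ u : ℕ))
      (fun i hi => φ.symm ⟨i, ((Finset.mem_Icc.1 hi).2.trans_lt hlt)⟩) ?_ ?_ ?_ ?_
    · intro u hu
      rw [mem_neighborFinset, hadj] at hu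
      exact Finset.mem_Icc.2 hu
    · intro i hi
      rw [mem_neighborFinset, hadj, RelIso.apply_symm_apply]
      exact Finset.mem_Icc.1 hi
    · intro u _
      simp
    · intro i _
      simp
  · by_cases h0 : (φ u : ℕ) = 0
    · have : φ u = z := Fin.ext h0
      rw [← this, RelIso.symm_apply_apply, dist_self]
      omega
    · by_cases hm : (φ u : ℕ) ≤ m
      · rw [dist_eq_one_iff_adj.2 ((hadj u).2 ⟨by omega, hm⟩)]
        omega
      · have hu := (φ u).2
        -- The parent of the outer vertex labelled `m + i` is the one labelled `i`.
        set w := φ.symm ⟨(φ u : ℕ) - m, by omega⟩ with hw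
        have h1 : T.Adj (φ.symm z) w := by
          rw [hadj, hw, RelIso.apply_symm_apply]
          simp only
          omega
        have h2 : T.Adj w u := by
          rw [← φ.map_adj_iff, hw, RelIso.apply_symm_apply, spur_adj, Fin.ne_iff_vne]
          simp only [SpurRel]
          omega
        exact dist_le (Walk.cons h1 (Walk.cons h2 Walk.nil))

end
end SimpleGraph

theorem theorem3p6 {V : Type*} [Fintype V] (T : SimpleGraph V) (hT : T.IsTree) (n α : ℕ)
    (hn : Fintype.card V = n) (hn2 : 2 ≤ n) (hα : T.indepNum = α) :
    hararyIndex T ≤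
        (3 * (n : ℝ) ^ 2 + 2 * (α : ℝ) * (n : ℝ) + (α : ℝ) ^ 2 - 9 * (α : ℝ)
          + 19 * (n : ℝ) - 22) / 24 ∧
      (hararyIndex T =
          (3 * (n : ℝ) ^ 2 + 2 * (α : ℝ) * (n : ℝ) + (α : ℝ) ^ 2 - 9 * (α : ℝ)
            + 19 * (n : ℝ) - 22) / 24 ↔
        Nonempty (T ≃g spur n α)) := by
  subst hn hα
  have : Nontrivial V := Fintype.one_lt_card_iff_nontrivial.1 hn2
  have h := hT.hararyIndex_le hn2
  refine ⟨h.1, h.2.trans ⟨fun ⟨c, hc⟩ => hT.nonempty_iso_spur hc, fun ⟨φ⟩ => ?_⟩⟩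
  exact hT.exists_isSpurCenter_of_iso φ
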